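/- Let $(\Sigma,<)$ be a finite totally ordered alphabet and let $L\subseteq\Sigma^*$ be an infinite regular language that is slender, i.e., for some constant $d>0$ it contains at most $d$ words of each length. Let $S=(L,\Sigma,<)$ be the abstract numeration system built on $L$: $\mathrm{rep}_S(n)$ denotes the $(n+1)$-st word of $L$ in the genealogical order (words are compared first by length, and words of equal length lexicographically), and a set $X\subseteq\mathbb{N}$ is called $S$-recognizable if $\mathrm{rep}_S(X)$ is a regular language. Then a set $X\subseteq\mathbb{N}$ is $S$-recognizable if and only if $X$ is a finite (possibly empty) union of arithmetic progressions $\{a+bn : n\ge 0\}$ with $a,b\in\mathbb{N}$ (where $b=0$ is allowed and gives a singleton). Consequently, if $X\subseteq\mathbb{N}$ is $S$-recognizable, then $\lambda X=\{\lambda x : x\in X\}$ is $S$-recognizable for every $\lambda\in\mathbb{N}$. -/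

import Mathlib

/-- An abstract numeration system: an infinite regular language over a finite alphabet `α` whose
letters are totally ordered (the order is the `LinearOrder` instance on `α`). -/
structure AbstractNumerationSystem (α : Type*) [LinearOrder α] [Finite α] where
  /-- the language of the system -/
  lang : Language α
  regular : lang.IsRegular
  infinite : Set.Infinite {w : List α | w ∈ lang}

/-- Genealogical (radix, shortlex) order on words: first by length, then lexicographically. -/
abbrev GenLT {α : Type*} [LinearOrder α] (v w : List α) : Prop :=
  List.Shortlex (fun a b : α => a < b) v w

theorem genLT_wellFounded (α : Type*) [LinearOrder α] [Finite α] :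
    WellFounded (GenLT : List α → List α → Prop) :=
  List.Shortlex.wf (Finite.to_wellFoundedLT (α := α)).wf

namespace AbstractNumerationSystem

variable {α : Type*} [LinearOrder α] [Finite α]

theorem exists_mem_not_earlier (S : AbstractNumerationSystem α) (n : ℕ)
    (f : ∀ m, m < n → List α) :
    {w : List α | w ∈ S.lang ∧ ∀ (m : ℕ) (h : m < n), w ≠ f m h}.Nonempty := by
  obtain ⟨w, hw, hn⟩ := (S.infinite.sdiff
    (Set.finite_range (fun i : Fin n => f i.1 i.2))).nonempty
  exact ⟨w, hw, fun m h e => hn ⟨⟨m, h⟩, e.symm⟩⟩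

/-- `S.rep n` is the `(n+1)`-st word of the genealogically ordered language of `S`: the least word
of the language different from `S.rep 0, …, S.rep (n-1)`. -/
noncomputable def rep (S : AbstractNumerationSystem α) (n : ℕ) : List α :=
  (genLT_wellFounded α).min
    {w : List α | w ∈ S.lang ∧ ∀ (m : ℕ) (_ : m < n), w ≠ S.rep m}
    (S.exists_mem_not_earlier n fun m _ => S.rep m)
termination_by n

theorem rep_spec (S : AbstractNumerationSystem α) (n : ℕ) :
    S.rep n ∈ S.lang ∧ ∀ m < n, S.rep n ≠ S.rep m := by
  have h := (genLT_wellFounded α).min_mem _ (S.exists_mem_not_earlier n fun m _ => S.rep m)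
  rw [rep]
  exact h

theorem rep_least (S : AbstractNumerationSystem α) (n : ℕ) {w : List α} (hw : w ∈ S.lang)
    (h : ∀ m < n, w ≠ S.rep m) : ¬ GenLT w (S.rep n) := by
  rw [rep]
  have hw' : w ∈ {w : List α | w ∈ S.lang ∧ ∀ (m : ℕ) (_ : m < n), w ≠ S.rep m} := ⟨hw, h⟩
  exact (genLT_wellFounded α).not_lt_min _ hw'

/-- The words `S.rep 0, S.rep 1, …` are genealogically increasing. -/
theorem rep_lt_rep (S : AbstractNumerationSystem α) {m n : ℕ} (h : m < n) :
    GenLT (S.rep m) (S.rep n) := by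
  have h1 := S.rep_least m (S.rep_spec n).1 fun k hk => (S.rep_spec n).2 k (hk.trans h)
  have h2 := (S.rep_spec n).2 m h
  by_contra h3
  exact h2 (Std.Trichotomous.trichotomous (r := GenLT) _ _ h1 h3)

/-- Every word of the language is a representation, and conversely. -/
theorem range_rep (S : AbstractNumerationSystem α) :
    Set.range S.rep = {w : List α | w ∈ S.lang} := by
  ext w
  constructor
  · rintro ⟨n, rfl⟩
    exact (S.rep_spec n).1
  · intro hw
    by_contra hn
    have hne : ∀ n, w ≠ S.rep n := fun n e => hn ⟨n, e.symm⟩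
    have hinj : Function.Injective S.rep := by
      intro a b hab
      rcases lt_trichotomy a b with h | h | h
      · exact absurd hab.symm ((S.rep_spec b).2 a h)
      · exact h
      · exact absurd hab ((S.rep_spec a).2 b h)
    have hlen : ∀ n, (S.rep n).length ≤ w.length := by
      intro n
      by_contra hl
      exact S.rep_least n hw (fun m _ => hne m) (List.Shortlex.of_length_lt (not_le.1 hl))
    exact Set.infinite_range_of_injective hinj
      ((List.finite_length_le α w.length).subset (by rintro _ ⟨n, rfl⟩; exact hlen n))

/-- `X` is `S`-recognizable if the language of the representations of its elements is regular. -/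
def Recognizable (S : AbstractNumerationSystem α) (X : Set ℕ) : Prop :=
  Language.IsRegular (S.rep '' X : Language α)

end AbstractNumerationSystem

/-- The number of words of length `n` in `L` (over a finite alphabet this set is finite). -/
noncomputable def wordCount {α : Type*} (L : Language α) (n : ℕ) : ℕ :=
  Set.ncard {w : List α | w ∈ L ∧ w.length = n}

/-- `L` is slender: it has at most `d` words of each length, for some constant `d > 0`. -/
def IsSlender {α : Type*} (L : Language α) : Prop :=
  ∃ d : ℕ, 0 < d ∧ ∀ n, wordCount L n ≤ d

/-- The arithmetic progression `{a + b n : n ≥ 0}`; for `b = 0` it is the singleton `{a}`. -/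
def arithProg (a b : ℕ) : Set ℕ := {x | ∃ n : ℕ, x = a + b * n}

/-- `X` is a finite (possibly empty) union of arithmetic progressions. -/
def IsFiniteUnionArithProg (X : Set ℕ) : Prop :=
  ∃ F : Finset (ℕ × ℕ), X = ⋃ p ∈ F, arithProg p.1 p.2

/-! The rank of a word in the regular language `L` is computable modulo any `m` by a finite
automaton reading from right to left (`Language.IsRegular.setOf_counts`). Since the rank of `S.rep
n` is `n`, residue classes are recognizable, and so are arithmetic progressions, which differ from
them by finitely many elements.

For the converse, slenderness makes the rank of `w` equal to the number of shorter words of `L` plus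
an offset at most `d`. An offset in this range is known once it is known modulo `d + 1`, so the
words of `S.rep '' X` with a given offset form a regular language, whose set of lengths is
eventually periodic. The number of words of each length is eventually periodic for the same reason.
Hence `X` is cut into blocks whose sizes and contents eventually repeat
(`isFiniteUnionArithProg_of_blocks`). Closure under multiplication is then visible on progressions.
-/

/-! ### Counting words of a regular language modulo `m` -/

section CountingWords

open scoped Classical

namespace Language

/-- The number of words of `K` of length less than `n`. -/
noncomputable def countBelow {α : Type*} (K : Language α) (n : ℕ) : ℕ :=
  Set.ncard {w : List α | w.length < n ∧ w ∈ K}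

/-- The number of words of `K` genealogically smaller than `w`. -/
noncomputable def rank {α : Type*} [LinearOrder α] (K : Language α) (w : List α) : ℕ :=
  Set.ncard {v : List α | GenLT v w ∧ v ∈ K}

end Language

theorem Set.ncard_list_eq_sum {α : Type*} [Fintype α] {T : Set (List α)} (hT : T.Finite) :
    T.ncard = (if [] ∈ T then 1 else 0) + ∑ b : α, Set.ncard {v : List α | b :: v ∈ T} := by
  have hfin : ∀ b : α, {v : List α | b :: v ∈ T}.Finite := fun b =>
    hT.preimage (List.cons_injective.injOn)
  have hU : T = (T ∩ {[]}) ∪ ⋃ b : α, List.cons b '' {v | b :: v ∈ T} := by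
    ext w
    cases w <;> simp
  have hdisj : Disjoint (T ∩ {[]}) (⋃ b : α, List.cons b '' {v | b :: v ∈ T}) := by
    rw [Set.disjoint_left]
    rintro w ⟨-, rfl⟩
    simp
  have h1 : (T ∩ {[]}).ncard = if [] ∈ T then 1 else 0 := by
    split_ifs with h
    · rw [Set.inter_eq_self_of_subset_right (by simpa using h), Set.ncard_singleton]
    · rw [Set.inter_singleton_eq_empty.2 h, Set.ncard_empty]
  have h2 : (⋃ b : α, List.cons b '' {v | b :: v ∈ T}).ncard
      = ∑ b : α, Set.ncard {v : List α | b :: v ∈ T} := by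
    rw [Set.ncard_iUnion_of_finite (fun b => (hfin b).image _), finsum_eq_sum_of_fintype]
    · exact Finset.sum_congr rfl fun b _ =>
        Set.ncard_image_of_injective _ List.cons_injective
    · intro a b hab
      rw [Function.onFun, Set.disjoint_left]
      rintro _ ⟨v, -, rfl⟩ ⟨u, -, hu⟩
      exact hab (List.cons.inj hu).1.symm
  conv_lhs => rw [hU]
  rw [Set.ncard_union_eq hdisj (hT.inter_of_left _)
    (Set.finite_iUnion fun b => (hfin b).image _), h1, h2]

namespace Language

theorem finite_length_lt_and_mem {α : Type*} [Finite α] (K : Language α) (n : ℕ) :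
    {w : List α | w.length < n ∧ w ∈ K}.Finite :=
  (List.finite_length_lt α n).subset fun _ hw => hw.1

theorem length_le_of_genLT {α : Type*} [LinearOrder α] {v w : List α} (h : GenLT v w) :
    v.length ≤ w.length := by
  rcases List.shortlex_def.1 h with h | h
  · exact h.le
  · exact h.1.le

theorem finite_genLT_and_mem {α : Type*} [LinearOrder α] [Finite α] (K : Language α)
    (w : List α) : {v : List α | GenLT v w ∧ v ∈ K}.Finite :=
  (List.finite_length_le α w.length).subset fun _ hw => length_le_of_genLT hw.1

theorem countBelow_add_one {α : Type*} [Finite α] (K : Language α) (n : ℕ) :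
    K.countBelow (n + 1) = K.countBelow n + wordCount K n := by
  rw [countBelow, countBelow, wordCount, ← Set.ncard_union_eq ?_ (finite_length_lt_and_mem K n)
    ((List.finite_length_eq α n).subset fun _ hw => hw.2)]
  · congr 1
    ext w
    simp only [Set.mem_ofPred_eq, Set.mem_union, Nat.lt_succ_iff_lt_or_eq]
    tauto
  · rw [Set.disjoint_left]
    rintro w ⟨h, -⟩ ⟨-, h'⟩
    omega

theorem countBelow_add_one_eq_sum {α : Type*} [Fintype α] (K : Language α) (n : ℕ) :
    K.countBelow (n + 1) = (if [] ∈ K then 1 else 0)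
      + ∑ b : α, (K.leftQuotient [b]).countBelow n := by
  rw [countBelow, Set.ncard_list_eq_sum (finite_length_lt_and_mem K _)]
  simp [countBelow]

theorem genLT_cons_cons_iff {α : Type*} [LinearOrder α] {a b : α} {v w : List α} :
    GenLT (b :: v) (a :: w) ↔
      v.length < w.length ∨ v.length = w.length ∧ (b < a ∨ b = a ∧ List.Lex (· < ·) v w) := by
  refine List.shortlex_def.trans ?_
  rw [List.cons_lex_cons_iff]
  simp

/-- Sort the smaller words by first letter `b`: the tail may be as long as `w` if `b < a`, must
precede `w` if `b = a`, and must be shorter than `w` if `b > a`. -/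
theorem rank_cons {α : Type*} [LinearOrder α] [Fintype α] (K : Language α) (a : α)
    (w : List α) :
    K.rank (a :: w) = (if [] ∈ K then 1 else 0) + ∑ b : α,
      if b < a then (K.leftQuotient [b]).countBelow (w.length + 1)
      else if b = a then (K.leftQuotient [b]).rank w
      else (K.leftQuotient [b]).countBelow w.length := by
  rw [rank, Set.ncard_list_eq_sum (finite_genLT_and_mem K _)]
  have h0 : GenLT [] (a :: w) := List.Shortlex.of_length_lt (by simp)
  simp only [Set.mem_ofPred_eq, h0, true_and]
  congr 1
  refine Finset.sum_congr rfl fun b _ => ?_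
  simp only [genLT_cons_cons_iff]
  split_ifs with h1 h2
  · simp [countBelow, h1, le_iff_lt_or_eq]
  · simp [rank, h2, List.shortlex_def]
  · simp [countBelow, h1, h2]

theorem countBelow_le_rank {α : Type*} [LinearOrder α] [Finite α] (K : Language α)
    (w : List α) : K.countBelow w.length ≤ K.rank w :=
  Set.ncard_le_ncard (fun _ hv => ⟨List.Shortlex.of_length_lt hv.1, hv.2⟩)
    (finite_genLT_and_mem K w)

theorem rank_le_countBelow {α : Type*} [LinearOrder α] [Finite α] (K : Language α)
    (w : List α) : K.rank w ≤ K.countBelow (w.length + 1) :=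
  Set.ncard_le_ncard (fun _ hv => ⟨Nat.lt_succ_of_le (length_le_of_genLT hv.1), hv.2⟩)
    (finite_length_lt_and_mem K _)

/-- A language is regular if membership can be decided by a finite automaton reading the letters
from right to left. -/
theorem IsRegular.of_foldr {α β : Type*} [Finite β] (f : List α → β) (g : α → β → β)
    (hf : ∀ a w, f (a :: w) = g a (f w)) (P : β → Prop) :
    IsRegular ({w | P (f w)} : Language α) := by
  have := Fintype.ofFinite β
  refine .of_reverse (isRegular_iff.2 ?_)
  refine ⟨β, inferInstance, ⟨fun s a => g a s, f [], {s | P s}⟩, ?_⟩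
  have key : ∀ w : List α, List.foldl (fun s a => g a s) (f []) w.reverse = f w := by
    intro w
    induction w with
    | nil => rfl
    | cons a w ih => simp [ih, hf]
  ext w
  change P (List.foldl (fun s a => g a s) (f []) w) ↔ P (f w.reverse)
  rw [← key w.reverse, List.reverse_reverse]

/-- All left quotients lie in the finite set of words of bounded length, so there are finitely many.
-/
theorem IsRegular.of_finite {α : Type*} [Finite α] {K : Language α}
    (hK : {w : List α | w ∈ K}.Finite) : K.IsRegular := by
  obtain ⟨N, hN⟩ := (hK.image List.length).bddAbove
  refine .of_finite_range_leftQuotient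
    ((List.finite_length_le α N).finite_subsets.subset ?_)
  rintro _ ⟨x, rfl⟩ v hv
  have := hN ⟨x ++ v, hv, rfl⟩
  simp at this ⊢
  omega

theorem _root_.DFA.leftQuotient_acceptsFrom {α σ : Type*} (M : DFA α σ) (q : σ) (b : α) :
    (M.acceptsFrom q).leftQuotient [b] = M.acceptsFrom (M.step q b) :=
  rfl

/-- Any condition on the rank of a word and on the numbers of shorter and of not longer words in a
regular language, all taken modulo `m`, defines a regular language. -/
theorem IsRegular.setOf_counts {α : Type*} [LinearOrder α] [Finite α] {K : Language α}
    (hK : K.IsRegular) (m : ℕ) [NeZero m] (P : ZMod m → ZMod m → ZMod m → Prop) :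
    IsRegular ({w | P (K.rank w) (K.countBelow w.length) (K.countBelow (w.length + 1))} :
      Language α) := by
  have := Fintype.ofFinite α
  obtain ⟨σ, _, M, rfl⟩ := hK
  -- The counts are kept for all starting states `q` at once, because stripping a first letter `b`
  -- replaces `q` by `M.step q b`.
  let f : List α → σ → ZMod m × ZMod m × ZMod m := fun w q =>
    (((M.acceptsFrom q).rank w : ZMod m), ((M.acceptsFrom q).countBelow w.length : ZMod m),
      ((M.acceptsFrom q).countBelow (w.length + 1) : ZMod m))
  let e : σ → ZMod m := fun q => if [] ∈ M.acceptsFrom q then 1 else 0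
  let g : α → (σ → ZMod m × ZMod m × ZMod m) → σ → ZMod m × ZMod m × ZMod m := fun a s q =>
    (e q + ∑ b : α, (if b < a then (s (M.step q b)).2.2 else if b = a then (s (M.step q b)).1
        else (s (M.step q b)).2.1),
      e q + ∑ b : α, (s (M.step q b)).2.1, e q + ∑ b : α, (s (M.step q b)).2.2)
  have hf : ∀ a w, f (a :: w) = g a (f w) := by
    intro a w
    funext q
    simp only [f, g, e, List.length_cons, rank_cons, countBelow_add_one_eq_sum _ w.length,
      countBelow_add_one_eq_sum _ (w.length + 1), DFA.leftQuotient_acceptsFrom]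
    push_cast
    rfl
  exact IsRegular.of_foldr f g hf fun s => P (s M.start).1 (s M.start).2.1 (s M.start).2.2

end Language

end CountingWords

/-! ### Eventual periodicity and blocks -/

section EventuallyPeriodic

/-- A predicate on the natural numbers that is periodic from some point on. -/
def EventuallyPeriodic (P : ℕ → Prop) : Prop :=
  ∃ N p : ℕ, 0 < p ∧ ∀ n, N ≤ n → (P (n + p) ↔ P n)

theorem EventuallyPeriodic.of_iterate {β : Type*} [Finite β] (u : ℕ → β) (g : β → β)
    (hu : ∀ n, u (n + 1) = g (u n)) (P : β → Prop) : EventuallyPeriodic fun n => P (u n) := by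
  obtain ⟨a, b, hab, h⟩ : ∃ a b, a < b ∧ u a = u b := by
    obtain ⟨a, b, hne, h⟩ := Finite.exists_ne_map_eq_of_infinite u
    rcases hne.lt_or_gt with hlt | hlt
    · exact ⟨a, b, hlt, h⟩
    · exact ⟨b, a, hlt, h.symm⟩
  have key : ∀ k, u (a + k + (b - a)) = u (a + k) := by
    intro k
    induction k with
    | zero => rw [add_zero, Nat.add_sub_cancel' hab.le, h]
    | succ k ih => rw [show a + (k + 1) + (b - a) = a + k + (b - a) + 1 by ring, hu, ih, ← hu,
        add_assoc]
  refine ⟨a, b - a, Nat.sub_pos_of_lt hab, fun n hn => ?_⟩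
  obtain ⟨k, rfl⟩ := Nat.exists_eq_add_of_le hn
  simp only [key]

theorem iff_add_mul_of_iff_add {P : ℕ → Prop} {N p : ℕ}
    (h : ∀ n, N ≤ n → (P (n + p) ↔ P n)) (t n : ℕ) (hn : N ≤ n) : P (n + p * t) ↔ P n := by
  induction t with
  | zero => rfl
  | succ t ih => rw [mul_add_one, ← add_assoc, h _ (hn.trans (Nat.le_add_right _ _)), ih]

theorem exists_common_period {ι : Type*} [Fintype ι] {P : ι → ℕ → Prop}
    (h : ∀ i, EventuallyPeriodic (P i)) :
    ∃ N p : ℕ, 0 < p ∧ ∀ i n, N ≤ n → (P i (n + p) ↔ P i n) := by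
  choose N p hp hP using h
  refine ⟨∑ i, N i, ∏ i, p i, Finset.prod_pos fun i _ => hp i, fun i n hn => ?_⟩
  obtain ⟨t, ht⟩ := Finset.dvd_prod_of_mem p (Finset.mem_univ i)
  rw [ht]
  exact iff_add_mul_of_iff_add (hP i) t n
    ((Finset.single_le_sum (fun _ _ => Nat.zero_le _) (Finset.mem_univ i)).trans hn)

theorem Language.IsRegular.eventuallyPeriodic_length {α : Type*} {K : Language α}
    (hK : K.IsRegular) : EventuallyPeriodic fun n => ∃ w ∈ K, w.length = n := by
  obtain ⟨σ, _, M, rfl⟩ := hK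
  -- Forgetting the letters leaves a deterministic walk on sets of states, which is eventually
  -- periodic by pigeonhole.
  let u : ℕ → Set σ := fun n => {s | ∃ w : List α, w.length = n ∧ M.eval w = s}
  have hu : ∀ n, u (n + 1) = {s | ∃ t ∈ u n, ∃ a, M.step t a = s} := by
    intro n
    ext s
    constructor
    · rintro ⟨w, hw, rfl⟩
      rcases List.eq_nil_or_concat' w with rfl | ⟨v, a, rfl⟩
      · simp at hw
      · exact ⟨_, ⟨v, by simpa using hw, rfl⟩, a, by simp⟩
    · rintro ⟨_, ⟨w, hw, rfl⟩, a, rfl⟩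
      exact ⟨w ++ [a], by simp [hw], by simp⟩
  convert EventuallyPeriodic.of_iterate u (fun T => {s | ∃ t ∈ T, ∃ a, M.step t a = s}) hu
    (fun T => ∃ s ∈ T, s ∈ M.accept) using 2 with n
  constructor
  · rintro ⟨w, hw, hn⟩
    exact ⟨_, ⟨w, hn, rfl⟩, hw⟩
  · rintro ⟨_, ⟨w, hn, rfl⟩, hw⟩
    exact ⟨w, hw, hn⟩

/-- A set formed of blocks whose contents and sizes are both eventually periodic is a finite union
of arithmetic progressions. -/
theorem isFiniteUnionArithProg_of_blocks {k K : ℕ → ℕ} {m : ℕ} {Q : Fin m → ℕ → Prop}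
    (hk : ∀ n, k n < m) (hper : ∀ i : Fin m, EventuallyPeriodic fun n => k n = i)
    (hK : ∀ n, K (n + 1) = K n + k n) (hQ : ∀ i, EventuallyPeriodic (Q i)) :
    IsFiniteUnionArithProg {x | ∃ i n, Q i n ∧ x = K n + i} := by
  classical
  obtain ⟨N, p, hp, h⟩ := exists_common_period (ι := Fin m ⊕ Fin m)
    (P := Sum.elim (fun i n => k n = i) Q) (by rintro (i | i); exacts [hper i, hQ i])
  have hkp : ∀ n, N ≤ n → k (n + p) = k n := fun n hn =>
    (h (.inl ⟨k n, hk n⟩) n hn).2 rfl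
  have hQp : ∀ i n, N ≤ n → (Q i (n + p) ↔ Q i n) := fun i n hn => h (.inr i) n hn
  obtain ⟨C, hC⟩ : ∃ C, ∀ n, N ≤ n → K (n + p) = K n + C := by
    refine ⟨K (N + p) - K N, fun n hn => ?_⟩
    have hmono : Monotone K := monotone_nat_of_le_succ fun n => by rw [hK]; omega
    induction n, hn using Nat.le_induction with
    | base => have := hmono (Nat.le_add_right N p); omega
    | succ n hn ih => rw [add_right_comm, hK, hK, ih, hkp n hn]; ring
  have hCt : ∀ t n, N ≤ n → K (n + p * t) = K n + C * t := by
    intro t n hn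
    induction t with
    | zero => rfl
    | succ t ih => rw [mul_add_one, ← add_assoc, hC _ (by omega), ih]; ring
  -- Blocks before `N` give singletons; each block of the first full period starts progressions of
  -- difference `C`, the total size of a period.
  refine ⟨((Finset.range (N + p) ×ˢ (Finset.univ : Finset (Fin m))).filter
    fun x => Q x.2 x.1).image fun x => (K x.1 + x.2, if x.1 < N then 0 else C), ?_⟩
  ext x
  simp only [Set.mem_ofPred_eq, Set.mem_iUnion, Finset.mem_image, Finset.mem_filter,
    Finset.mem_product, Finset.mem_range, Finset.mem_univ, and_true, arithProg, exists_prop]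
  constructor
  · rintro ⟨i, n, hq, rfl⟩
    by_cases hn : n < N
    · exact ⟨_, ⟨(n, i), ⟨by simp; omega, hq⟩, rfl⟩, 0, by simp⟩
    · obtain ⟨r, rfl⟩ := Nat.exists_eq_add_of_le (not_lt.1 hn)
      have hr : N + r = N + r % p + p * (r / p) := by rw [add_assoc, Nat.mod_add_div]
      rw [hr, iff_add_mul_of_iff_add (hQp i) _ _ (by omega)] at hq
      refine ⟨_, ⟨(N + r % p, i), ⟨by simpa using Nat.mod_lt r hp, hq⟩, rfl⟩, r / p, ?_⟩
      rw [hr, hCt _ _ (by omega)]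
      simp
      ring
  · rintro ⟨_, ⟨⟨n, i⟩, ⟨hn, hq⟩, rfl⟩, t, rfl⟩
    by_cases hN : n < N
    · exact ⟨i, n, hq, by simp [hN]⟩
    · refine ⟨i, n + p * t, (iff_add_mul_of_iff_add (hQp i) _ _ (not_lt.1 hN)).2 hq, ?_⟩
      rw [hCt _ _ (not_lt.1 hN)]
      simp [hN]
      ring

end EventuallyPeriodic

/-! ### Recognizable sets and arithmetic progressions -/

namespace AbstractNumerationSystem

variable {α : Type*} [LinearOrder α] [Finite α]

theorem rep_lt_rep_iff (S : AbstractNumerationSystem α) {m n : ℕ} :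
    GenLT (S.rep m) (S.rep n) ↔ m < n := by
  refine ⟨fun h => ?_, S.rep_lt_rep⟩
  by_contra hmn
  rcases (not_lt.1 hmn).eq_or_lt with rfl | hlt
  · exact Std.Asymm.asymm _ _ h h
  · exact Std.Asymm.asymm _ _ h (S.rep_lt_rep hlt)

theorem rep_injective (S : AbstractNumerationSystem α) : Function.Injective S.rep := by
  intro a b hab
  rcases lt_trichotomy a b with h | h | h
  · exact absurd hab.symm ((S.rep_spec b).2 a h)
  · exact h
  · exact absurd hab ((S.rep_spec a).2 b h)

theorem mem_lang_iff (S : AbstractNumerationSystem α) {w : List α} :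
    w ∈ S.lang ↔ ∃ n, S.rep n = w :=
  (Set.ext_iff.1 S.range_rep w).symm

theorem rank_rep (S : AbstractNumerationSystem α) (n : ℕ) : S.lang.rank (S.rep n) = n := by
  have h : {v : List α | GenLT v (S.rep n) ∧ v ∈ S.lang} = S.rep '' Set.Iio n := by
    ext v
    constructor
    · rintro ⟨h, hv⟩
      obtain ⟨m, rfl⟩ := S.mem_lang_iff.1 hv
      exact ⟨m, S.rep_lt_rep_iff.1 h, rfl⟩
    · rintro ⟨m, hm, rfl⟩
      exact ⟨S.rep_lt_rep hm, (S.rep_spec m).1⟩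
  rw [Language.rank, h, Set.ncard_image_of_injective _ S.rep_injective]
  simp

theorem recognizable_of_finite (S : AbstractNumerationSystem α) {X : Set ℕ} (hX : X.Finite) :
    S.Recognizable X :=
  .of_finite (hX.image S.rep)

theorem Recognizable.union {S : AbstractNumerationSystem α} {X Y : Set ℕ}
    (hX : S.Recognizable X) (hY : S.Recognizable Y) : S.Recognizable (X ∪ Y) := by
  rw [Recognizable, Set.image_union]
  exact Language.IsRegular.add hX hY

theorem Recognizable.diff {S : AbstractNumerationSystem α} {X Y : Set ℕ}
    (hX : S.Recognizable X) (hY : S.Recognizable Y) : S.Recognizable (X \ Y) := by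
  rw [Recognizable, Set.image_sdiff S.rep_injective]
  exact Language.IsRegular.inf hX hY.compl

theorem recognizable_modEq (S : AbstractNumerationSystem α) (a b : ℕ) [NeZero b] :
    S.Recognizable {x : ℕ | (x : ZMod b) = a} := by
  have h : (S.rep '' {x : ℕ | (x : ZMod b) = a} : Language α)
      = S.lang ⊓ ({w | (S.lang.rank w : ZMod b) = a} : Language α) := by
    ext w
    constructor
    · rintro ⟨x, hx, rfl⟩
      refine ⟨(S.rep_spec x).1, ?_⟩
      change (S.lang.rank (S.rep x) : ZMod b) = a
      rwa [S.rank_rep]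
    · rintro ⟨hw, hx⟩
      obtain ⟨x, rfl⟩ := S.mem_lang_iff.1 hw
      change (S.lang.rank (S.rep x) : ZMod b) = a at hx
      rw [S.rank_rep] at hx
      exact ⟨x, hx, rfl⟩
  rw [Recognizable, h]
  exact S.regular.inf (S.regular.setOf_counts b fun r _ _ => r = a)

theorem recognizable_arithProg (S : AbstractNumerationSystem α) (a b : ℕ) :
    S.Recognizable (arithProg a b) := by
  rcases Nat.eq_zero_or_pos b with rfl | hb
  · exact S.recognizable_of_finite ((Set.finite_singleton a).subset (by simp [arithProg]))
  · have : NeZero b := ⟨hb.ne'⟩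
    have h : arithProg a b = {x : ℕ | (x : ZMod b) = a} \ Set.Iio a := by
      ext x
      simp only [arithProg, Set.mem_ofPred_eq, Set.mem_sdiff, Set.mem_Iio, not_lt]
      constructor
      · rintro ⟨n, rfl⟩
        simp
      · rintro ⟨h, hx⟩
        obtain ⟨n, hn⟩ :=
          (Nat.modEq_iff_dvd' hx).1 ((ZMod.natCast_eq_natCast_iff _ _ _).1 h.symm)
        exact ⟨n, by omega⟩
    rw [h]
    exact (S.recognizable_modEq a b).diff (S.recognizable_of_finite (Set.finite_Iio a))

theorem recognizable_of_isFiniteUnionArithProg (S : AbstractNumerationSystem α) {X : Set ℕ}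
    (hX : IsFiniteUnionArithProg X) : S.Recognizable X := by
  classical
  obtain ⟨F, rfl⟩ := hX
  induction F using Finset.induction_on with
  | empty => exact S.recognizable_of_finite (by simp)
  | insert p F _ ih =>
    rw [Finset.set_biUnion_insert]
    exact (S.recognizable_arithProg p.1 p.2).union ih

theorem exists_length_eq (S : AbstractNumerationSystem α) (n : ℕ) :
    ∃ w : List α, w.length = n := by
  obtain ⟨w, -, hw⟩ := (S.infinite.sdiff (Set.finite_singleton [])).nonempty
  cases w with
  | nil => exact absurd rfl hw
  | cons a _ => exact ⟨List.replicate n a, by simp⟩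

theorem natCast_zmod_eq_iff {a b m : ℕ} (ha : a < m) (hb : b < m) :
    (a : ZMod m) = b ↔ a = b := by
  rw [ZMod.natCast_eq_natCast_iff, Nat.ModEq, Nat.mod_eq_of_lt ha, Nat.mod_eq_of_lt hb]

theorem isFiniteUnionArithProg_of_recognizable (S : AbstractNumerationSystem α)
    (hS : IsSlender S.lang) {X : Set ℕ} (hX : S.Recognizable X) : IsFiniteUnionArithProg X := by
  obtain ⟨d, -, hd⟩ := hS
  have hlt : ∀ n, wordCount S.lang n < d + 1 := fun n => Nat.lt_succ_of_le (hd n)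
  have hrank : ∀ w, ∃ r, r < d + 1 ∧ S.lang.rank w = S.lang.countBelow w.length + r := by
    intro w
    have h1 := S.lang.countBelow_le_rank w
    have h2 := S.lang.rank_le_countBelow w
    rw [S.lang.countBelow_add_one] at h2
    have := hlt w.length
    exact ⟨S.lang.rank w - S.lang.countBelow w.length, by omega, by omega⟩
  -- `R i` collects the representations of elements of `X` that are preceded by exactly `i` words of
  -- `S.lang` of their own length.
  let R : Fin (d + 1) → Language α := fun i =>
    (S.rep '' X : Language α) ⊓ ({w | (S.lang.rank w : ZMod (d + 1))
      = S.lang.countBelow w.length + (i : ℕ)} : Language α)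
  have hR : ∀ i, (R i).IsRegular := fun i =>
    Language.IsRegular.inf hX (S.regular.setOf_counts (d + 1) fun r c _ => r = c + (i : ℕ))
  have hper : ∀ i : Fin (d + 1), EventuallyPeriodic fun n => wordCount S.lang n = i := by
    intro i
    convert (S.regular.setOf_counts (d + 1)
      fun _ c c' => c' = c + (i : ℕ)).eventuallyPeriodic_length using 2 with n
    have key : (S.lang.countBelow (n + 1) : ZMod (d + 1)) = S.lang.countBelow n + (i : ℕ)
        ↔ wordCount S.lang n = i := by
      rw [S.lang.countBelow_add_one, Nat.cast_add, add_right_inj,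
        natCast_zmod_eq_iff (hlt n) i.2]
    rw [← key]
    constructor
    · intro h
      -- The condition depends only on the length, and `w` need not belong to `S.lang`, which may
      -- have no word of length `n`.
      obtain ⟨w, rfl⟩ := S.exists_length_eq n
      exact ⟨w, h, rfl⟩
    · rintro ⟨w, h, rfl⟩
      exact h
  have hXeq : X = {x | ∃ i n, (∃ w ∈ R i, w.length = n)
      ∧ x = S.lang.countBelow n + (i : Fin (d + 1))} := by
    have hmem : ∀ (x : ℕ) (i : Fin (d + 1)), S.rep x ∈ R i ↔
        x ∈ X ∧ x = S.lang.countBelow (S.rep x).length + i := by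
      intro x i
      obtain ⟨r, hr, hxr⟩ := hrank (S.rep x)
      have h1 : S.rep x ∈ R i ↔ S.rep x ∈ S.rep '' X ∧
        (S.lang.rank (S.rep x) : ZMod (d + 1))
          = S.lang.countBelow (S.rep x).length + (i : ℕ) := Iff.rfl
      rw [h1, S.rep_injective.mem_set_image, hxr, Nat.cast_add, add_right_inj,
        natCast_zmod_eq_iff hr i.2]
      rw [S.rank_rep] at hxr
      refine and_congr_right fun _ => ?_
      omega
    ext x
    constructor
    · intro hx
      obtain ⟨r, hr, hxr⟩ := hrank (S.rep x)
      rw [S.rank_rep] at hxr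
      exact ⟨⟨r, hr⟩, _, ⟨_, (hmem x ⟨r, hr⟩).2 ⟨hx, hxr⟩, rfl⟩, hxr⟩
    · rintro ⟨i, _, ⟨w, hw, rfl⟩, hx⟩
      obtain ⟨y, hy, rfl⟩ := hw.1
      rw [← ((hmem y i).1 hw).2] at hx
      rwa [hx]
  rw [hXeq]
  exact isFiniteUnionArithProg_of_blocks hlt hper S.lang.countBelow_add_one
    fun i => (hR i).eventuallyPeriodic_length

end AbstractNumerationSystem

theorem IsFiniteUnionArithProg.image_mul {X : Set ℕ} (hX : IsFiniteUnionArithProg X) (c : ℕ) :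
    IsFiniteUnionArithProg ((fun x => c * x) '' X) := by
  classical
  obtain ⟨F, rfl⟩ := hX
  refine ⟨F.image fun p => (c * p.1, c * p.2), ?_⟩
  rw [Set.image_iUnion₂, Finset.set_biUnion_finset_image]
  refine Set.iUnion₂_congr fun p _ => ?_
  ext x
  simp [arithProg, mul_add, mul_assoc, eq_comm]

theorem mainTheorem6 {α : Type*} [LinearOrder α] [Finite α] (S : AbstractNumerationSystem α)
    (hS : IsSlender S.lang) :
    (∀ X : Set ℕ, S.Recognizable X ↔ IsFiniteUnionArithProg X) ∧
    (∀ X : Set ℕ, S.Recognizable X →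
      ∀ c : ℕ, S.Recognizable ((fun x => c * x) '' X)) :=
  ⟨fun _ => ⟨S.isFiniteUnionArithProg_of_recognizable hS,
      S.recognizable_of_isFiniteUnionArithProg⟩,
    fun _ hX c => S.recognizable_of_isFiniteUnionArithProg
      ((S.isFiniteUnionArithProg_of_recognizable hS hX).image_mul c)⟩
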